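/- **Theorem 3.1 (Densities of projections).** There is an absolute constant $C>0$ such that the following holds. Let $n\ge 0$, let $X_1,\dots,X_n$ be independent real-valued random variables on a probability space, each having a density with respect to Lebesgue measure on $\mathbb R$ that is bounded by $K$ almost everywhere, where $K\in\mathbb R$, and let $X=(X_1,\dots,X_n)$. Let $E\subseteq\mathbb R^n$ be a linear subspace of dimension $d$ and let $P$ be the orthogonal projection of $\mathbb R^n$ onto $E$. Then the random vector $PX$ has a density with respect to the $d$-dimensional Lebesgue measure on $E$ (the counting measure on $\{0\}$ when $d=0$), and this density is bounded by $(CK)^d$ almost everywhere. -/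

import Mathlib

open MeasureTheory

/-- The random vector `PX`, where `X = (X₁, …, Xₙ)` and `P` is the orthogonal projection
of `ℝⁿ` (with the Euclidean inner product) onto the subspace `E`. -/
noncomputable def projectedVector {Ω : Type*} {n : ℕ} (X : Fin n → Ω → ℝ)
    (E : Submodule ℝ (EuclideanSpace ℝ (Fin n))) (ω : Ω) : E :=
  E.orthogonalProjectionOnto (WithLp.toLp 2 (fun i => X i ω))

/-- The measure `volume` on a linear subspace `E` of `ℝⁿ` is the Lebesgue measure of `E` as a
Euclidean space of its own dimension: the Haar measure giving mass one to the unit cube of any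
orthonormal basis of `E` (and not the restriction of the `n`-dimensional measure). -/
theorem subspace_volume_eq {n d : ℕ} (E : Submodule ℝ (EuclideanSpace ℝ (Fin n)))
    (b : OrthonormalBasis (Fin d) ℝ E) : (volume : Measure E) = b.toBasis.addHaar :=
  b.addHaar_eq_volume.symm

/-!
Why the theorem holds, with `C = 2 * √e`. Suppose first that the densities `f i` are continuous and
positive. The density of `PX` at `y ∈ E` is the integral of `∏ i, f i (y i + z i)` over `z ∈ Eᗮ`,
and `z i = ⟪w i, z⟫`, where the projections `w i` of the standard basis vectors onto `Eᗮ` form a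
Parseval frame. This integral is bounded by a form of the geometric rank-one Brascamp–Lieb
inequality (`lintegral_prod_le_of_parseval`), proved by Barthe's transport method: with
`c i = ‖w i‖ ^ 2 ∈ [0, 1]`, let `S i` transport `f i` to the centred Gaussian density proportional
to `exp (-π s ^ 2 / c i)`. As `f i ≤ K`, one has `f i ≤ K ^ (1 - c i) * f i ^ c i`, which turns into
`f i ≤ (√e * K) ^ (1 - c i) * (S i)' ^ c i * exp (-π (S i) ^ 2)` (`exists_gaussian_transport`). The
map `Θ z = ∑ i, S i ⟪w i, z⟫ • w i` is injective, its Jacobian is at least `∏ i, (S i)' ^ c i`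
(`prod_rpow_le_det_of_parseval`) and `‖Θ‖ ^ 2 ≤ ∑ i, (S i) ^ 2`
(`norm_sum_smul_sq_le_of_parseval`). So the change of variables `Θ` compares the integral with that
of a standard Gaussian, and since `∑ i, c i = dim Eᗮ` the constant is `(√e * K) ^ dim E`.

Arbitrary densities bounded by `K` are almost everywhere limits of positive continuous ones bounded
by `2 * K` (`exists_continuous_density_approx`), and Fatou's lemma carries over the bound on the
probability that `PX` lies in a given measurable set (`setLIntegral_prod_le`). A law which is at
most a multiple of the volume has a density bounded by that multiple (`hasPDF_of_map_le`).
-/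

/-! ### Monotone transport on the line -/

open Filter Topology in
/-- A positive continuous probability density has a strictly increasing primitive with limits
`0` and `1`, its distribution function. -/
theorem exists_distribution_function {f : ℝ → ℝ} (hf : Continuous f) (hpos : ∀ x, 0 < f x)
    (hint : Integrable f) (h1 : ∫ x, f x = 1) :
    ∃ F : ℝ → ℝ, (∀ x, HasDerivAt F (f x) x) ∧ StrictMono F ∧
      Tendsto F atBot (𝓝 0) ∧ Tendsto F atTop (𝓝 1) := by
  set A := ∫ x in Set.Iic 0, f x
  have hder : ∀ x, HasDerivAt (fun x => A + ∫ u in (0 : ℝ)..x, f u) (f x) x := fun x =>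
    (intervalIntegral.integral_hasDerivAt_right (hf.intervalIntegrable _ _)
      (hf.stronglyMeasurableAtFilter _ _) hf.continuousAt).const_add A
  refine ⟨_, hder, ?_, ?_, ?_⟩
  · exact strictMono_of_hasDerivAt_pos hder hpos
  · have := (intervalIntegral_tendsto_integral_Iic (μ := volume) 0 hint.integrableOn
      tendsto_id).neg.const_add A
    rw [show A + -∫ x in Set.Iic 0, f x = 0 from add_neg_cancel A] at this
    refine this.congr fun x => ?_
    rw [id, ← intervalIntegral.integral_symm]
  · have := (intervalIntegral_tendsto_integral_Ioi (μ := volume) 0 hint.integrableOn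
      tendsto_id).const_add A
    have h2 : A + ∫ x in Set.Ioi 0, f x = 1 := by
      rw [← h1]; exact intervalIntegral.integral_Iic_add_Ioi hint.integrableOn hint.integrableOn
    rw [h2] at this
    exact this

open Filter Topology in
/-- Monotone transport on the line: there is a map pushing the density `f` forward to `g`. Only
the resulting differential equation `T' = f / g ∘ T` is recorded. -/
theorem exists_transport {f g : ℝ → ℝ} (hf : Continuous f) (hfpos : ∀ x, 0 < f x)
    (hfint : Integrable f) (hf1 : ∫ x, f x = 1) (hg : Continuous g) (hgpos : ∀ x, 0 < g x)
    (hgint : Integrable g) (hg1 : ∫ x, g x = 1) :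
    ∃ T : ℝ → ℝ, ∀ x, HasDerivAt T (f x / g (T x)) x := by
  obtain ⟨F, hF, hFm, hF0, hF1⟩ := exists_distribution_function hf hfpos hfint hf1
  obtain ⟨G, hG, hGm, hG0, hG1⟩ := exists_distribution_function hg hgpos hgint hg1
  have hGc : Continuous G := continuous_iff_continuousAt.2 fun x => (hG x).continuousAt
  have hFpos : ∀ x, 0 < F x := fun x =>
    (hFm.monotone.le_of_tendsto hF0 (x - 1)).trans_lt (hFm (by linarith))
  have hFlt : ∀ x, F x < 1 := fun x =>
    (hFm (by linarith : x < x + 1)).trans_le (hFm.monotone.ge_of_tendsto hF1 (x + 1))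
  have hsurj : ∀ p, 0 < p → p < 1 → ∃ s, G s = p := by
    intro p hp0 hp1
    obtain ⟨a, ha⟩ := (hG0.eventually_lt_const hp0).exists
    obtain ⟨b, hb⟩ := (hG1.eventually_const_lt hp1).exists
    exact mem_range_of_exists_le_of_exists_ge hGc ⟨a, ha.le⟩ ⟨b, hb.le⟩
  choose! H hH using hsurj
  have hHc : ∀ p, 0 < p → p < 1 → ContinuousAt H p := by
    intro p hp0 hp1
    have hev : ∀ᶠ q in 𝓝 p, 0 < q ∧ q < 1 :=
      (eventually_gt_nhds hp0).and (eventually_lt_nhds hp1)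
    refine tendsto_order.2 ⟨fun a ha => ?_, fun b hb => ?_⟩
    · have : G a < p := by rw [← hH p hp0 hp1]; exact hGm ha
      filter_upwards [hev, eventually_gt_nhds this] with q hq h
      rw [← hH q hq.1 hq.2] at h
      exact hGm.lt_iff_lt.1 h
    · have : p < G b := by rw [← hH p hp0 hp1]; exact hGm hb
      filter_upwards [hev, eventually_lt_nhds this] with q hq h
      rw [← hH q hq.1 hq.2] at h
      exact hGm.lt_iff_lt.1 h
  refine ⟨H ∘ F, fun x => ?_⟩
  have hinv : HasDerivAt H (g (H (F x)))⁻¹ (F x) := by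
    refine HasDerivAt.of_local_left_inverse (hHc _ (hFpos x) (hFlt x)) (hG _) (hgpos _).ne' ?_
    filter_upwards [eventually_gt_nhds (hFpos x), eventually_lt_nhds (hFlt x)] with q h0 h1
    exact hH q h0 h1
  have := hinv.comp x (hF x)
  simpa [div_eq_inv_mul] using this

/-- The pointwise form in which the transport of `f` to a centred Gaussian of variance
proportional to `c` is used. The hypothesis `c = 0 → x = 0` covers a degenerate direction, in
which only the value at the origin matters. -/
theorem exists_gaussian_transport {f : ℝ → ℝ} (hf : Continuous f) (hfpos : ∀ x, 0 < f x)
    (hfint : Integrable f) (hf1 : ∫ x, f x = 1) {K c : ℝ} (hfK : ∀ x, f x ≤ K)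
    (hc0 : 0 ≤ c) (hc1 : c ≤ 1) :
    ∃ S S' : ℝ → ℝ, (∀ x, HasDerivAt S (S' x) x) ∧ (∀ x, 0 < S' x) ∧
      ∀ x, (c = 0 → x = 0) →
        f x ≤ (Real.exp (1 / 2) * K) ^ (1 - c) * S' x ^ c * Real.exp (-Real.pi * S x ^ 2) := by
  have hK : 0 < K := (hfpos 0).trans_le (hfK 0)
  rcases hc0.eq_or_lt with rfl | hc
  · refine ⟨id, fun _ => 1, fun x => hasDerivAt_id x, fun _ => one_pos, fun x hx => ?_⟩
    obtain rfl := hx rfl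
    have : 1 ≤ Real.exp (1 / 2) := Real.one_le_exp (by norm_num)
    simpa using (hfK 0).trans (le_mul_of_one_le_left hK.le this)
  have hsc : 0 < Real.sqrt c := Real.sqrt_pos.2 hc
  have hpc : 0 < Real.pi / c := div_pos Real.pi_pos hc
  let g : ℝ → ℝ := fun s => Real.exp (-(Real.pi / c) * s ^ 2) / Real.sqrt c
  have hg1 : ∫ s, g s = 1 := by
    simp only [g]
    rw [integral_div, integral_gaussian, div_div_cancel₀ Real.pi_pos.ne', div_self hsc.ne']
  have hgpos : ∀ s, 0 < g s := fun s => by positivity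
  obtain ⟨S, hS⟩ := exists_transport hf hfpos hfint hf1 (g := g) (by fun_prop) hgpos
    ((integrable_exp_neg_mul_sq hpc).div_const _) hg1
  refine ⟨S, _, hS, fun x => div_pos (hfpos x) (hgpos _), fun x _ => ?_⟩
  -- Write `f = f ^ (1 - c) * f ^ c` and `f = S' * (g ∘ S)`; the normalisation of `g` contributes
  -- `c ^ (-c / 2) ≤ e ^ ((1 - c) / 2)`.
  have hgc : (g (S x)) ^ c = c ^ (-(c / 2)) * Real.exp (-Real.pi * S x ^ 2) := by
    simp only [g]
    rw [Real.div_rpow (Real.exp_pos _).le hsc.le, ← Real.exp_mul, Real.sqrt_eq_rpow,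
      ← Real.rpow_mul hc.le, Real.rpow_neg hc.le, div_eq_inv_mul]
    congr 2
    · congr 1; ring
    · field_simp
  have hcc : c ^ (-(c / 2)) ≤ Real.exp (1 / 2) ^ (1 - c) := by
    rw [Real.rpow_def_of_pos hc, ← Real.exp_mul]
    apply Real.exp_le_exp.2
    have := Real.one_sub_inv_le_log_of_pos hc
    have h2 : c * (1 - c⁻¹) = c - 1 := by field_simp
    nlinarith [mul_le_mul_of_nonneg_left this hc.le]
  have hfx := hfpos x
  calc f x = f x ^ (1 - c) * f x ^ c := by
        rw [← Real.rpow_add hfx]; simp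
    _ = f x ^ (1 - c) * ((f x / g (S x)) ^ c * g (S x) ^ c) := by
        rw [← Real.mul_rpow (div_pos hfx (hgpos _)).le (hgpos _).le,
          div_mul_cancel₀ _ (hgpos _).ne']
    _ ≤ K ^ (1 - c) * ((f x / g (S x)) ^ c *
          (Real.exp (1 / 2) ^ (1 - c) * Real.exp (-Real.pi * S x ^ 2))) := by
        rw [hgc]
        have := div_pos hfx (hgpos (S x))
        gcongr
        exact hfK x
    _ = _ := by
        rw [Real.mul_rpow (Real.exp_pos _).le hK.le]; ring

/-! ### Parseval frames and the Brascamp–Lieb inequality -/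

section ParsevalFrame

variable {ι V : Type*} [Fintype ι] [NormedAddCommGroup V] [InnerProductSpace ℝ V]
  {w : ι → V}

theorem norm_sq_le_one_of_parseval (hw : ∀ z, ∑ i, inner ℝ (w i) z ^ 2 = ‖z‖ ^ 2) (i : ι) :
    ‖w i‖ ^ 2 ≤ 1 := by
  have h : inner ℝ (w i) (w i) ^ 2 ≤ ‖w i‖ ^ 2 := by
    rw [← hw (w i)]
    exact Finset.single_le_sum (f := fun j => inner ℝ (w j) (w i) ^ 2)
      (fun j _ => sq_nonneg _) (Finset.mem_univ i)
  rw [real_inner_self_eq_norm_sq] at h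
  nlinarith [sq_nonneg ‖w i‖]

theorem norm_sum_smul_sq_le_of_parseval (hw : ∀ z, ∑ i, inner ℝ (w i) z ^ 2 = ‖z‖ ^ 2)
    (t : ι → ℝ) : ‖∑ i, t i • w i‖ ^ 2 ≤ ∑ i, t i ^ 2 := by
  set y := ∑ i, t i • w i with hy
  have h1 : ‖y‖ ^ 2 = ∑ i, t i * inner ℝ (w i) y := by
    rw [← real_inner_self_eq_norm_sq]
    conv_lhs => rw [hy, sum_inner]
    simp_rw [inner_smul_left, RCLike.conj_to_real, ← hy]
  have h2 : 0 ≤ ∑ i, (t i - inner ℝ (w i) y) ^ 2 := Finset.sum_nonneg fun i _ => sq_nonneg _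
  have h3 : ∑ i, (t i - inner ℝ (w i) y) ^ 2 =
      ∑ i, t i ^ 2 - 2 * ∑ i, t i * inner ℝ (w i) y + ∑ i, inner ℝ (w i) y ^ 2 := by
    rw [Finset.mul_sum, ← Finset.sum_sub_distrib, ← Finset.sum_add_distrib]
    exact Finset.sum_congr rfl fun i _ => by ring
  rw [h3, hw, ← h1] at h2
  linarith

variable [FiniteDimensional ℝ V]

theorem sum_norm_sq_of_parseval (hw : ∀ z, ∑ i, inner ℝ (w i) z ^ 2 = ‖z‖ ^ 2) :
    ∑ i, ‖w i‖ ^ 2 = Module.finrank ℝ V := by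
  let v := stdOrthonormalBasis ℝ V
  calc ∑ i, ‖w i‖ ^ 2 = ∑ i, ∑ j, inner ℝ (w i) (v j) ^ 2 := by
        simp_rw [v.sum_sq_inner_left]
    _ = ∑ j, ‖v j‖ ^ 2 := by rw [Finset.sum_comm]; simp_rw [hw]
    _ = _ := by simp

/-- The determinant inequality behind the rank-one Brascamp–Lieb inequality. Each eigenvalue is a
weighted arithmetic mean of the `s i`, hence at least the corresponding geometric mean, and these
geometric means multiply up to the left-hand side. -/
theorem prod_rpow_le_det_of_parseval (hw : ∀ z, ∑ i, inner ℝ (w i) z ^ 2 = ‖z‖ ^ 2)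
    {s : ι → ℝ} (hs : ∀ i, 0 < s i) {A : V →ₗ[ℝ] V}
    (hA : ∀ z, A z = ∑ i, (s i * inner ℝ (w i) z) • w i) :
    ∏ i, s i ^ (‖w i‖ ^ 2) ≤ LinearMap.det A := by
  have hsym : A.IsSymmetric := by
    intro x y
    rw [hA, hA, sum_inner, inner_sum]
    refine Finset.sum_congr rfl fun i _ => ?_
    rw [inner_smul_left, inner_smul_right, RCLike.conj_to_real, real_inner_comm x (w i)]
    ring
  let v := hsym.eigenvectorBasis rfl
  rw [hsym.det_eq_prod_eigenvalues rfl]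
  have hv : ∀ j, ∑ i, inner ℝ (w i) (v j) ^ 2 = 1 := fun j => by rw [hw]; simp
  have hlam : ∀ j, hsym.eigenvalues rfl j = ∑ i, inner ℝ (w i) (v j) ^ 2 * s i := by
    intro j
    have h1 : inner ℝ (A (v j)) (v j) = hsym.eigenvalues rfl j := by
      rw [hsym.apply_eigenvectorBasis rfl j, inner_smul_left]
      simp [v]
    rw [← h1, hA, sum_inner]
    refine Finset.sum_congr rfl fun i _ => ?_
    rw [inner_smul_left, RCLike.conj_to_real]
    ring
  calc ∏ i, s i ^ (‖w i‖ ^ 2) = ∏ i, ∏ j, s i ^ (inner ℝ (w i) (v j) ^ 2) := by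
        refine Finset.prod_congr rfl fun i _ => ?_
        rw [← Real.rpow_sum_of_pos (hs i), v.sum_sq_inner_left]
    _ = ∏ j, ∏ i, s i ^ (inner ℝ (w i) (v j) ^ 2) := Finset.prod_comm
    _ ≤ ∏ j, hsym.eigenvalues rfl j := by
        refine Finset.prod_le_prod
          (fun j _ => Finset.prod_nonneg fun i _ => Real.rpow_nonneg (hs i).le _) fun j _ => ?_
        rw [hlam]
        exact Real.geom_mean_le_arith_mean_weighted _ _ _ (fun i _ => sq_nonneg _) (hv j)
          fun i _ => (hs i).le
    _ = _ := rfl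

variable [MeasurableSpace V] [BorelSpace V]

theorem lintegral_gaussian_eq_one :
    ∫⁻ z : V, ENNReal.ofReal (Real.exp (-Real.pi * ‖z‖ ^ 2)) = 1 := by
  have h := GaussianFourier.integral_rexp_neg_mul_sq_norm (V := V) Real.pi_pos
  rw [div_self Real.pi_pos.ne', Real.one_rpow] at h
  rw [← ofReal_integral_eq_lintegral_ofReal _ (ae_of_all _ fun z => (Real.exp_pos _).le), h,
    ENNReal.ofReal_one]
  -- the integral of a non-integrable function would be `0`
  by_contra hni
  rw [integral_undef hni] at h
  exact zero_ne_one h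

/-- A form of the geometric rank-one Brascamp–Lieb inequality, for densities bounded by `K`. The
exponent is `∑ i, (1 - ‖w i‖ ^ 2)`. -/
theorem lintegral_prod_le_of_parseval (hw : ∀ z, ∑ i, inner ℝ (w i) z ^ 2 = ‖z‖ ^ 2)
    {f : ι → ℝ → ℝ} (hf : ∀ i, Continuous (f i)) (hpos : ∀ i x, 0 < f i x)
    (hint : ∀ i, Integrable (f i)) (h1 : ∀ i, ∫ x, f i x = 1) {K : ℝ} (hK : 0 < K)
    (hfK : ∀ i x, f i x ≤ K) :
    ∫⁻ z : V, ENNReal.ofReal (∏ i, f i (inner ℝ (w i) z)) ≤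
      ENNReal.ofReal ((Real.exp (1 / 2) * K) ^ ((Fintype.card ι : ℝ) - Module.finrank ℝ V)) := by
  set M := Real.exp (1 / 2) * K
  have hM : 0 < M := by positivity
  choose S S' hS hS' hle using fun i => exists_gaussian_transport (hf i) (hpos i) (hint i) (h1 i)
    (hfK i) (sq_nonneg ‖w i‖) (norm_sq_le_one_of_parseval hw i)
  let Θ : V → V := fun z => ∑ i, S i (inner ℝ (w i) z) • w i
  let Θ' : V → V →L[ℝ] V := fun z =>
    ∑ i, (S' i (inner ℝ (w i) z) • innerSL ℝ (w i)).smulRight (w i)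
  have hΘ : ∀ z, HasFDerivAt Θ (Θ' z) z := by
    intro z
    refine HasFDerivAt.fun_sum fun i _ => ?_
    have := (hS i (inner ℝ (w i) z)).comp_hasFDerivAt z (innerSL ℝ (w i)).hasFDerivAt
    exact this.smul_const (w i)
  -- `⟪Θ x - Θ y, x - y⟫` is a sum of nonnegative terms, so all terms vanish if `Θ x = Θ y`
  have hΘinj : Function.Injective Θ := by
    intro x y hxy
    have hmono : ∀ i, StrictMono (S i) := fun i => strictMono_of_hasDerivAt_pos (hS i) (hS' i)
    have h0 : ∑ i, (S i (inner ℝ (w i) x) - S i (inner ℝ (w i) y)) *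
        (inner ℝ (w i) x - inner ℝ (w i) y) = 0 := by
      have : inner ℝ (Θ x - Θ y) (x - y) = (0 : ℝ) := by rw [hxy]; simp
      rw [← this]
      simp only [Θ]
      rw [← Finset.sum_sub_distrib, sum_inner]
      refine Finset.sum_congr rfl fun i _ => ?_
      rw [← sub_smul, inner_smul_left, RCLike.conj_to_real, ← inner_sub_right]
    have hnn : ∀ i, 0 ≤ (S i (inner ℝ (w i) x) - S i (inner ℝ (w i) y)) *
        (inner ℝ (w i) x - inner ℝ (w i) y) := by
      intro i
      rcases le_total (inner ℝ (w i) x) (inner ℝ (w i) y) with h | h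
      · exact mul_nonneg_of_nonpos_of_nonpos (sub_nonpos.2 ((hmono i).monotone h))
          (sub_nonpos.2 h)
      · exact mul_nonneg (sub_nonneg.2 ((hmono i).monotone h)) (sub_nonneg.2 h)
    have heq : ∀ i, inner ℝ (w i) (x - y) = (0 : ℝ) := by
      intro i
      have := (Finset.sum_eq_zero_iff_of_nonneg fun i _ => hnn i).1 h0 i (Finset.mem_univ i)
      rw [inner_sub_right]
      rcases mul_eq_zero.1 this with h | h
      · rw [(hmono i).injective (sub_eq_zero.1 h), sub_self]
      · exact h
    have := hw (x - y)
    simp only [heq] at this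
    simpa [sub_eq_zero] using this.symm
  have hdet : ∀ z, ∏ i, S' i (inner ℝ (w i) z) ^ (‖w i‖ ^ 2) ≤ |(Θ' z).det| := by
    intro z
    refine le_trans ?_ (le_abs_self _)
    refine prod_rpow_le_det_of_parseval hw (fun i => hS' i _) fun y => ?_
    simp [Θ']
  have hpt : ∀ z, ∏ i, f i (inner ℝ (w i) z) ≤
      M ^ ((Fintype.card ι : ℝ) - Module.finrank ℝ V) *
        (|(Θ' z).det| * Real.exp (-Real.pi * ‖Θ z‖ ^ 2)) := by
    intro z
    have hdeg : ∀ i, ‖w i‖ ^ 2 = 0 → inner ℝ (w i) z = (0 : ℝ) := by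
      intro i hi
      rw [norm_eq_zero.1 (pow_eq_zero_iff two_ne_zero |>.1 hi), inner_zero_left]
    have hexp : ∏ i, Real.exp (-Real.pi * S i (inner ℝ (w i) z) ^ 2) ≤
        Real.exp (-Real.pi * ‖Θ z‖ ^ 2) := by
      rw [← Real.exp_sum, ← Finset.mul_sum, Real.exp_le_exp]
      have := norm_sum_smul_sq_le_of_parseval hw fun i => S i (inner ℝ (w i) z)
      nlinarith [Real.pi_pos]
    calc ∏ i, f i (inner ℝ (w i) z) ≤ ∏ i, (M ^ (1 - ‖w i‖ ^ 2) *
          S' i (inner ℝ (w i) z) ^ (‖w i‖ ^ 2) *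
            Real.exp (-Real.pi * S i (inner ℝ (w i) z) ^ 2)) :=
          Finset.prod_le_prod (fun i _ => (hpos i _).le) fun i _ => hle i _ (hdeg i)
      _ = M ^ ((Fintype.card ι : ℝ) - Module.finrank ℝ V) *
          ((∏ i, S' i (inner ℝ (w i) z) ^ (‖w i‖ ^ 2)) *
            ∏ i, Real.exp (-Real.pi * S i (inner ℝ (w i) z) ^ 2)) := by
          rw [Finset.prod_mul_distrib, Finset.prod_mul_distrib, ← Real.rpow_sum_of_pos hM,
            Finset.sum_sub_distrib, sum_norm_sq_of_parseval hw]
          simp [mul_assoc]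
      _ ≤ _ := by
          gcongr
          exact hdet z
  calc ∫⁻ z : V, ENNReal.ofReal (∏ i, f i (inner ℝ (w i) z))
      ≤ ∫⁻ z : V, ENNReal.ofReal (M ^ ((Fintype.card ι : ℝ) - Module.finrank ℝ V)) *
          (ENNReal.ofReal |(Θ' z).det| * ENNReal.ofReal (Real.exp (-Real.pi * ‖Θ z‖ ^ 2))) := by
        refine lintegral_mono fun z => ?_
        rw [← ENNReal.ofReal_mul (abs_nonneg _), ← ENNReal.ofReal_mul (by positivity)]
        exact ENNReal.ofReal_le_ofReal (hpt z)
    _ = ENNReal.ofReal (M ^ ((Fintype.card ι : ℝ) - Module.finrank ℝ V)) *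
          ∫⁻ z in Set.range Θ, ENNReal.ofReal (Real.exp (-Real.pi * ‖z‖ ^ 2)) := by
        rw [lintegral_const_mul' _ _ ENNReal.ofReal_ne_top, ← Set.image_univ,
          lintegral_image_eq_lintegral_abs_det_fderiv_mul volume MeasurableSet.univ
            (fun z _ => (hΘ z).hasFDerivWithinAt) hΘinj.injOn, Measure.restrict_univ]
    _ ≤ ENNReal.ofReal (M ^ ((Fintype.card ι : ℝ) - Module.finrank ℝ V)) * 1 := by
        gcongr
        rw [← lintegral_gaussian_eq_one (V := V)]
        exact setLIntegral_le_lintegral _ _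
    _ = _ := mul_one _

end ParsevalFrame

/-! ### Fibres of the orthogonal projection -/

theorem inner_orthogonalProjectionOnto_single {ι : Type*} [Fintype ι] [DecidableEq ι]
    (F : Submodule ℝ (EuclideanSpace ℝ ι)) (i : ι) (z : F) :
    inner ℝ (F.orthogonalProjectionOnto (EuclideanSpace.single i 1)) z =
      (z : EuclideanSpace ℝ ι) i := by
  rw [Submodule.inner_orthogonalProjectionOnto_eq_of_mem_right, EuclideanSpace.inner_single_left]
  simp

/-- The images of the standard basis under the orthogonal projection onto a subspace form a
Parseval frame of that subspace. -/
theorem sum_inner_orthogonalProjectionOnto_single_sq {ι : Type*} [Fintype ι] [DecidableEq ι]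
    (F : Submodule ℝ (EuclideanSpace ℝ ι)) (z : F) :
    ∑ i, inner ℝ (F.orthogonalProjectionOnto (EuclideanSpace.single i 1)) z ^ 2 = ‖z‖ ^ 2 := by
  simp_rw [inner_orthogonalProjectionOnto_single, Submodule.coe_norm,
    EuclideanSpace.real_norm_sq_eq]

/-- The probability that `PX` lies in `A`, for positive continuous densities: by Fubini it is an
integral over `A` of fibre integrals over translates of `Eᗮ`, which the Brascamp–Lieb inequality
bounds. -/
theorem setLIntegral_prod_le_of_continuous {ι : Type*} [Fintype ι]
    (E : Submodule ℝ (EuclideanSpace ℝ ι))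
    {f : ι → ℝ → ℝ} (hf : ∀ i, Continuous (f i)) (hpos : ∀ i x, 0 < f i x)
    (hint : ∀ i, Integrable (f i)) (h1 : ∀ i, ∫ x, f i x = 1) {K : ℝ} (hK : 0 < K)
    (hfK : ∀ i x, f i x ≤ K) {A : Set E} (hA : MeasurableSet A) :
    ∫⁻ x : ι → ℝ in {x | E.orthogonalProjectionOnto (WithLp.toLp 2 x) ∈ A},
        ENNReal.ofReal (∏ i, f i (x i)) ≤
      ENNReal.ofReal ((Real.exp (1 / 2) * K) ^ Module.finrank ℝ E) * volume A := by
  classical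
  let M := Real.exp (1 / 2) * K
  let h : EuclideanSpace ℝ ι → ENNReal := fun x => ENNReal.ofReal (∏ i, f i (x i))
  have hh : Measurable h := by
    have : Continuous fun x : EuclideanSpace ℝ ι => ∏ i, f i (x i) :=
      continuous_finsetProd _ fun i _ => (hf i).comp (by fun_prop)
    exact this.measurable.ennreal_ofReal
  let B : Set (EuclideanSpace ℝ ι) := {x | E.orthogonalProjectionOnto x ∈ A}
  have hB : MeasurableSet B := E.orthogonalProjectionOnto.continuous.measurable hA
  have hfib : ∀ y : E, ∫⁻ z : Eᗮ, h (y + z) ≤ ENNReal.ofReal (M ^ Module.finrank ℝ E) := by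
    intro y
    have := lintegral_prod_le_of_parseval (sum_inner_orthogonalProjectionOnto_single_sq Eᗮ)
      (f := fun i t => f i ((y : EuclideanSpace ℝ ι) i + t))
      (fun i => (hf i).comp (by fun_prop)) (fun i t => hpos i _)
      (fun i => (hint i).comp_add_left _)
      (fun i => by rw [integral_add_left_eq_self (f i), h1]) hK (fun i t => hfK i _)
    have hdim : (Fintype.card ι : ℝ) - Module.finrank ℝ Eᗮ = (Module.finrank ℝ E : ℕ) := by
      have := E.finrank_add_finrank_orthogonal
      rw [finrank_euclideanSpace] at this
      rw [← this]; push_cast; ring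
    rw [hdim, Real.rpow_natCast] at this
    simp_rw [inner_orthogonalProjectionOnto_single] at this
    exact this
  have hmp : MeasurePreserving
      (fun p : E × Eᗮ => E.orthogonalDecomposition.symm (WithLp.toLp 2 p)) :=
    E.orthogonalDecomposition.symm.measurePreserving.comp (WithLp.volume_preserving_toLp E Eᗮ)
  calc ∫⁻ x : ι → ℝ in {x | E.orthogonalProjectionOnto (WithLp.toLp 2 x) ∈ A},
        ENNReal.ofReal (∏ i, f i (x i))
      = ∫⁻ x in B, h x :=
        (PiLp.volume_preserving_toLp ι).setLIntegral_comp_preimage hB hh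
    _ = ∫⁻ x, B.indicator h x := (lintegral_indicator hB h).symm
    _ = ∫⁻ p : E × Eᗮ, A.indicator (fun _ => h (p.1 + p.2)) p.1 := by
        rw [← hmp.lintegral_comp (hh.indicator hB)]
        refine lintegral_congr fun p => ?_
        have hp : E.orthogonalDecomposition.symm (WithLp.toLp 2 p) = p.1 + p.2 := by simp
        have hp1 : E.orthogonalProjectionOnto ((p.1 : EuclideanSpace ℝ ι) + p.2) = p.1 := by
          simp
        rw [hp]
        by_cases hpA : p.1 ∈ A
        · rw [Set.indicator_of_mem hpA, Set.indicator_of_mem (by simpa [B, hp1] using hpA)]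
        · rw [Set.indicator_of_notMem hpA, Set.indicator_of_notMem (by simpa [B, hp1] using hpA)]
    _ ≤ ∫⁻ y : E, ∫⁻ z : Eᗮ, A.indicator (fun _ => h (y + z)) y := by
        rw [Measure.volume_eq_prod]
        exact lintegral_prod_le _
    _ ≤ ∫⁻ y : E, A.indicator (fun _ => ENNReal.ofReal (M ^ Module.finrank ℝ E)) y := by
        refine lintegral_mono fun y => ?_
        by_cases hy : y ∈ A
        · simpa only [Set.indicator_of_mem hy] using hfib y
        · simp [Set.indicator_of_notMem hy]
    _ = _ := by rw [lintegral_indicator_const hA]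

/-! ### Approximation of bounded densities -/

open Filter Topology in
/-- A bounded probability density is an almost everywhere limit of positive continuous
probability densities with (up to the factor `2`) the same bound. -/
theorem exists_continuous_density_approx {f : ℝ → ℝ} (hint : Integrable f) (h0 : ∀ x, 0 ≤ f x)
    (h1 : ∫ x, f x = 1) {K : ℝ} (hK : 0 < K) (hfK : ∀ x, f x ≤ K) :
    ∃ φ : ℕ → ℝ → ℝ, (∀ k, Continuous (φ k)) ∧ (∀ k x, 0 < φ k x) ∧ (∀ k, Integrable (φ k)) ∧
      (∀ k, ∫ x, φ k x = 1) ∧ (∀ k x, φ k x ≤ 2 * K) ∧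
      ∀ᵐ x, Tendsto (fun k => φ k x) atTop (𝓝 (f x)) := by
  let γ : ℝ → ℝ := fun x => Real.exp (-Real.pi * x ^ 2)
  have hγint : Integrable γ := integrable_exp_neg_mul_sq Real.pi_pos
  have hγ1 : ∫ x, γ x = 1 := by
    simp only [γ]
    rw [integral_gaussian, div_self Real.pi_pos.ne', Real.sqrt_one]
  have hγle : ∀ x, γ x ≤ 1 := fun x =>
    Real.exp_le_one_iff.2 (by nlinarith [Real.pi_pos, sq_nonneg x])
  -- this choice of `δ` gives `(K + δ k) / (1 - 2 * δ k) ≤ 2 * K`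
  let δ : ℕ → ℝ := fun k => min (1 / 8) (K / 4) / (k + 1)
  have hm : 0 < min (1 / 8) (K / 4) := lt_min (by norm_num) (by linarith)
  have hδ0 : ∀ k, 0 < δ k := fun k => by positivity
  have hδm : ∀ k, δ k ≤ min (1 / 8) (K / 4) := fun k =>
    div_le_self hm.le (by linarith [k.cast_nonneg (α := ℝ)])
  have hδ8 : ∀ k, δ k ≤ 1 / 8 := fun k => (hδm k).trans (min_le_left _ _)
  have hδK : ∀ k, δ k ≤ K / 4 := fun k => (hδm k).trans (min_le_right _ _)
  have hδt : Tendsto δ atTop (𝓝 0) :=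
    tendsto_const_nhds.div_atTop (tendsto_atTop_add_const_right _ _ tendsto_natCast_atTop_atTop)
  choose g _ hgle hgc hgint using fun k => hint.exists_hasCompactSupport_integral_sub_le (hδ0 k)
  -- truncate to `[0, K]` and add a small multiple of a Gaussian for positivity
  let h : ℕ → ℝ → ℝ := fun k x => max 0 (min (g k x) K) + δ k * γ x
  have hhc : ∀ k, Continuous (h k) := fun k => by
    have := hgc k
    fun_prop
  have hhpos : ∀ k x, 0 < h k x := fun k x =>
    add_pos_of_nonneg_of_pos (le_max_left _ _) (mul_pos (hδ0 k) (Real.exp_pos _))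
  have hhle : ∀ k x, h k x ≤ K + δ k := fun k x =>
    add_le_add (max_le hK.le (min_le_right _ _)) (mul_le_of_le_one_right (hδ0 k).le (hγle x))
  have hclose : ∀ k x, |f x - h k x| ≤ ‖f x - g k x‖ + δ k * γ x := by
    intro k x
    have hγx : 0 < δ k * γ x := mul_pos (hδ0 k) (Real.exp_pos _)
    have hcl : |f x - max 0 (min (g k x) K)| ≤ |f x - g k x| := by
      have := abs_max_sub_max_le_abs (min (f x) K) (min (g k x) K) 0
      rw [min_eq_left (hfK x), max_eq_left (h0 x), max_comm] at this
      refine this.trans ?_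
      simpa [min_eq_left (hfK x)] using abs_min_sub_min_le_max (f x) K (g k x) K
    rw [Real.norm_eq_abs]
    calc |f x - h k x| = |(f x - max 0 (min (g k x) K)) - δ k * γ x| := by
          simp only [h]; congr 1; ring
      _ ≤ |f x - max 0 (min (g k x) K)| + |δ k * γ x| := abs_sub _ _
      _ ≤ _ := by rw [abs_of_pos hγx]; linarith
  have hdom : ∀ k, Integrable fun x => ‖f x - g k x‖ + δ k * γ x := fun k =>
    (hint.sub (hgint k)).norm.add (hγint.const_mul _)
  have hdiff : ∀ k, Integrable fun x => f x - h k x := fun k =>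
    (hdom k).mono' (hint.aestronglyMeasurable.sub (hhc k).aestronglyMeasurable)
      (ae_of_all _ (hclose k))
  have hhint : ∀ k, Integrable (h k) := fun k => by
    have := hint.sub (hdiff k)
    simpa [Pi.sub_def] using this
  have hL1 : ∀ k, ∫ x, |f x - h k x| ≤ 2 * δ k := by
    intro k
    calc ∫ x, |f x - h k x| ≤ ∫ x, (‖f x - g k x‖ + δ k * γ x) :=
          integral_mono (hdiff k).abs (hdom k) (hclose k)
      _ = (∫ x, ‖f x - g k x‖) + δ k := by
          rw [integral_add (f := fun x => ‖f x - g k x‖) (hint.sub (hgint k)).norm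
            (hγint.const_mul _), integral_const_mul, hγ1, mul_one]
      _ ≤ _ := by linarith [hgle k]
  have hI : ∀ k, |1 - ∫ x, h k x| ≤ 2 * δ k := by
    intro k
    rw [← h1, ← integral_sub hint (hhint k)]
    exact abs_integral_le_integral_abs.trans (hL1 k)
  have hI34 : ∀ k, 3 / 4 ≤ ∫ x, h k x := fun k => by
    linarith [(abs_le.1 (hI k)).2, hδ8 k]
  have hIt : Tendsto (fun k => ∫ x, h k x) atTop (𝓝 1) := by
    rw [tendsto_iff_norm_sub_tendsto_zero]
    refine squeeze_zero (fun _ => norm_nonneg _) (fun k => ?_) (by simpa using hδt.const_mul 2)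
    rw [norm_sub_rev]
    exact hI k
  have hmeas : TendstoInMeasure volume h atTop f := by
    refine tendstoInMeasure_of_tendsto_eLpNorm one_ne_zero
      (fun k => (hhc k).aestronglyMeasurable) hint.aestronglyMeasurable ?_
    have hto : Tendsto (fun k => ENNReal.ofReal (2 * δ k)) atTop (𝓝 0) := by
      have := ENNReal.tendsto_ofReal (hδt.const_mul 2)
      simpa using this
    refine tendsto_of_tendsto_of_tendsto_of_le_of_le tendsto_const_nhds hto
      (fun _ => zero_le) fun k => ?_
    change eLpNorm (h k - f) 1 volume ≤ ENNReal.ofReal (2 * δ k)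
    rw [eLpNorm_sub_comm, eLpNorm_one_eq_lintegral_enorm]
    refine le_trans (le_of_eq ?_) (ENNReal.ofReal_le_ofReal (hL1 k))
    exact (ofReal_integral_norm_eq_lintegral_enorm (hdiff k)).symm
  obtain ⟨ns, hns, hae⟩ := hmeas.exists_seq_tendsto_ae
  refine ⟨fun k x => h (ns k) x / ∫ x, h (ns k) x, fun k => (hhc _).div_const _,
    fun k x => div_pos (hhpos _ _) (by linarith [hI34 (ns k)]), fun k => (hhint _).div_const _,
    fun k => ?_, fun k x => ?_, ?_⟩
  · rw [integral_div, div_self]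
    linarith [hI34 (ns k)]
  · have h34 := hI34 (ns k)
    rw [div_le_iff₀ (by linarith)]
    nlinarith [hhle (ns k) x, hδK (ns k)]
  · filter_upwards [hae] with x hx
    have := hx.div (hIt.comp hns.tendsto_atTop) one_ne_zero
    rw [div_one] at this
    exact this

open Filter Topology in
theorem setLIntegral_prod_le {ι : Type*} [Fintype ι] (E : Submodule ℝ (EuclideanSpace ℝ ι))
    {f : ι → ℝ → ℝ} (hint : ∀ i, Integrable (f i)) (h0 : ∀ i x, 0 ≤ f i x)
    (h1 : ∀ i, ∫ x, f i x = 1) {K : ℝ} (hK : 0 < K) (hfK : ∀ i x, f i x ≤ K)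
    {A : Set E} (hA : MeasurableSet A) :
    ∫⁻ x : ι → ℝ in {x | E.orthogonalProjectionOnto (WithLp.toLp 2 x) ∈ A},
        ENNReal.ofReal (∏ i, f i (x i)) ≤
      ENNReal.ofReal ((Real.exp (1 / 2) * (2 * K)) ^ Module.finrank ℝ E) * volume A := by
  choose φ hc hpos hφint hφ1 hφK hlim using fun i =>
    exists_continuous_density_approx (hint i) (h0 i) (h1 i) hK (hfK i)
  set B := {x : ι → ℝ | E.orthogonalProjectionOnto (WithLp.toLp 2 x) ∈ A}
  have hae : ∀ᵐ x : ι → ℝ, ∀ i, Tendsto (fun k => φ i k (x i)) atTop (𝓝 (f i (x i))) :=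
    eventually_all.2 fun i => 
      (Measure.tendsto_eval_ae_ae (μ := fun _ : ι => (volume : Measure ℝ))).eventually (hlim i)
  have hmeas : ∀ k, Measurable fun x : ι → ℝ => ENNReal.ofReal (∏ i, φ i k (x i)) := fun k => by
    have : Continuous fun x : ι → ℝ => ∏ i, φ i k (x i) :=
      continuous_finsetProd _ fun i _ => (hc i k).comp (continuous_apply i)
    exact this.measurable.ennreal_ofReal
  calc ∫⁻ x in B, ENNReal.ofReal (∏ i, f i (x i))
      = ∫⁻ x in B, liminf (fun k => ENNReal.ofReal (∏ i, φ i k (x i))) atTop := by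
        refine lintegral_congr_ae (ae_restrict_of_ae ?_)
        filter_upwards [hae] with x hx
        exact (ENNReal.tendsto_ofReal (tendsto_finsetProd _ fun i _ => hx i)).liminf_eq.symm
    _ ≤ liminf (fun k => ∫⁻ x in B, ENNReal.ofReal (∏ i, φ i k (x i))) atTop :=
        lintegral_liminf_le hmeas
    _ ≤ _ := by
        refine liminf_le_of_le (by isBoundedDefault) fun b hb => ?_
        obtain ⟨k, hk⟩ := hb.exists
        exact hk.trans (setLIntegral_prod_le_of_continuous E (fun i => hc i k)
          (fun i => hpos i k) (fun i => hφint i k) (fun i => hφ1 i k) (by linarith)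
          (fun i => hφK i k) hA)

/-! ### Laws and densities -/

theorem pi_withDensity_ofReal {ι : Type*} [Fintype ι] {f : ι → ℝ → ℝ}
    (hint : ∀ i, Integrable (f i)) (h0 : ∀ i x, 0 ≤ f i x) :
    Measure.pi (fun i => (volume : Measure ℝ).withDensity fun t => ENNReal.ofReal (f i t)) =
      (volume : Measure (ι → ℝ)).withDensity fun x => ENNReal.ofReal (∏ i, f i (x i)) := by
  refine Measure.pi_eq fun s hs => ?_
  have hint' : ∀ i, Integrable ((s i).indicator (f i)) := fun i => (hint i).indicator (hs i)
  have h0' : ∀ i x, 0 ≤ (s i).indicator (f i) x := fun i x =>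
    Set.indicator_nonneg (fun _ _ => h0 i _) x
  rw [withDensity_apply _ (.univ_pi hs)]
  have hprod : ∀ x : ι → ℝ, (Set.univ.pi s).indicator
      (fun x => ENNReal.ofReal (∏ i, f i (x i))) x =
        ENNReal.ofReal (∏ i, (s i).indicator (f i) (x i)) := by
    intro x
    by_cases hx : x ∈ Set.univ.pi s
    · rw [Set.indicator_of_mem hx]
      congr 1
      exact Finset.prod_congr rfl fun i _ => (Set.indicator_of_mem (hx i trivial) _).symm
    · rw [Set.indicator_of_notMem hx]
      obtain ⟨i, hi⟩ : ∃ i, x i ∉ s i := by simpa [Set.mem_pi] using hx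
      rw [Finset.prod_eq_zero (Finset.mem_univ i) (Set.indicator_of_notMem hi _),
        ENNReal.ofReal_zero]
  rw [← lintegral_indicator (.univ_pi hs), lintegral_congr hprod,
    ← ofReal_integral_eq_lintegral_ofReal (μ := (volume : Measure (ι → ℝ)))
      (Integrable.fintype_prod hint')
      (ae_of_all _ fun x => Finset.prod_nonneg fun i _ => h0' i _),
    integral_fintype_prod_volume_eq_prod fun i => (s i).indicator (f i),
    ENNReal.ofReal_prod_of_nonneg fun i _ => integral_nonneg (h0' i)]
  refine Finset.prod_congr rfl fun i _ => ?_
  rw [integral_indicator (hs i), withDensity_apply _ (hs i),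
    ofReal_integral_eq_lintegral_ofReal (hint i).integrableOn (ae_of_all _ (h0 i))]

open ProbabilityTheory in
theorem hasPDF_of_map_le {Ω V : Type*} [MeasurableSpace Ω] [MeasurableSpace V] {μ : Measure Ω}
    [IsFiniteMeasure μ] {ν : Measure V} [SigmaFinite ν] {Y : Ω → V} (hY : AEMeasurable Y μ)
    {c : ENNReal} (h : ∀ A, MeasurableSet A → μ.map Y A ≤ c * ν A) :
    HasPDF Y μ ν ∧ ∀ᵐ y ∂ν, pdf Y μ ν y ≤ c := by
  refine ⟨⟨hY, inferInstance, ?_⟩, ?_⟩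
  · refine Measure.AbsolutelyContinuous.mk fun A hA h0 => ?_
    simpa [h0] using h A hA
  · refine ae_le_of_forall_setLIntegral_le_of_sigmaFinite (measurable_pdf Y μ ν) fun A hA _ => ?_
    rw [setLIntegral_const]
    exact (setLIntegral_pdf_le_map Y μ ν A).trans (h A hA)

/-- A random variable whose density is at most `K` almost everywhere has a density version that
is at most `K` everywhere. -/
theorem exists_density_le {Ω : Type*} [MeasurableSpace Ω] {μ : Measure Ω} [IsProbabilityMeasure μ]
    {X : Ω → ℝ} [HasPDF X μ volume] {K : ℝ} (hK : 0 ≤ K)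
    (h : ∀ᵐ t ∂(volume : Measure ℝ), pdf X μ volume t ≤ ENNReal.ofReal K) :
    ∃ f : ℝ → ℝ, Integrable f ∧ (∀ x, 0 ≤ f x) ∧ ∫ x, f x = 1 ∧ (∀ x, f x ≤ K) ∧
      μ.map X = (volume : Measure ℝ).withDensity fun t => ENNReal.ofReal (f t) := by
  let f : ℝ → ℝ := fun t => min (pdf X μ volume t).toReal K
  have hmeas : Measurable f := (measurable_pdf X μ volume).ennreal_toReal.min measurable_const
  have h0 : ∀ x, 0 ≤ f x := fun x => le_min ENNReal.toReal_nonneg hK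
  have hae : (fun t => ENNReal.ofReal (f t)) =ᵐ[volume] pdf X μ volume := by
    filter_upwards [h] with t ht
    have hf : f t = (pdf X μ volume t).toReal :=
      min_eq_left (ENNReal.toReal_le_of_le_ofReal hK ht)
    rw [hf, ENNReal.ofReal_toReal (ht.trans_lt ENNReal.ofReal_lt_top).ne]
  have hlint : ∫⁻ t, ENNReal.ofReal (f t) = 1 := by
    rw [lintegral_congr_ae hae, pdf.lintegral_eq_measure_univ, measure_univ]
  refine ⟨f, ⟨hmeas.aestronglyMeasurable, ?_⟩, h0, ?_, fun x => min_le_right _ _, ?_⟩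
  · rw [hasFiniteIntegral_iff_ofReal (ae_of_all _ h0), hlint]
    exact ENNReal.one_lt_top
  · rw [integral_eq_lintegral_of_nonneg_ae (ae_of_all _ h0) hmeas.aestronglyMeasurable, hlint,
      ENNReal.toReal_one]
  · rw [map_eq_withDensity_pdf X μ volume, withDensity_congr_ae hae]

theorem theorem3p1 :
    ∃ C : ℝ, 0 < C ∧
      ∀ (Ω : Type*) [MeasurableSpace Ω] (μ : Measure Ω) [IsProbabilityMeasure μ]
        (n : ℕ) (X : Fin n → Ω → ℝ) (K : ℝ),
        ProbabilityTheory.iIndepFun X μ →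
        (∀ i, HasPDF (X i) μ volume) →
        (∀ i, ∀ᵐ t ∂(volume : Measure ℝ), pdf (X i) μ volume t ≤ ENNReal.ofReal K) →
        ∀ (d : ℕ) (E : Submodule ℝ (EuclideanSpace ℝ (Fin n))),
          Module.finrank ℝ E = d →
          HasPDF (projectedVector X E) μ volume ∧
            ∀ᵐ y ∂(volume : Measure E),
              pdf (projectedVector X E) μ volume y ≤
                ENNReal.ofReal ((C * K) ^ d) := by
  refine ⟨Real.exp (1 / 2) * 2, by positivity, ?_⟩
  intro Ω _ μ _ n X K hindep hpdf hbound d E hd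
  wlog hK : 0 < K generalizing K
  · -- a probability density is not almost everywhere zero, so `K ≤ 0` forces `n = 0` and `d = 0`
    have hempty : IsEmpty (Fin n) := by
      refine ⟨fun i => ?_⟩
      have := hpdf i
      have hz : pdf (X i) μ volume =ᵐ[volume] 0 := by
        filter_upwards [hbound i] with t ht
        rw [ENNReal.ofReal_of_nonpos (not_lt.1 hK)] at ht
        simpa using ht
      have h1 := pdf.lintegral_eq_measure_univ (ℙ := μ) (μ := volume) (X := X i)
      rw [lintegral_congr_ae hz] at h1
      simp at h1
    have hd0 : d = 0 := by
      rw [← hd]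
      exact Module.finrank_zero_of_subsingleton
    have := this 1 (fun i => hempty.elim i) one_pos
    simpa [hd0] using this
  choose f hint h0 h1 hfK hlaw using fun i => have := hpdf i; exists_density_le hK.le (hbound i)
  have hX : ∀ i, AEMeasurable (X i) μ := fun i => (hpdf i).aemeasurable
  have hXv : AEMeasurable (fun ω i => X i ω) μ := aemeasurable_pi_lambda _ hX
  have hjoint : μ.map (fun ω i => X i ω) =
      (volume : Measure (Fin n → ℝ)).withDensity fun x => ENNReal.ofReal (∏ i, f i (x i)) := by
    rw [(ProbabilityTheory.iIndepFun_iff_map_fun_eq_pi_map hX).1 hindep, funext hlaw,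
      pi_withDensity_ofReal hint h0]
  have hP : Measurable fun x : Fin n → ℝ => E.orthogonalProjectionOnto (WithLp.toLp 2 x) :=
    E.orthogonalProjectionOnto.continuous.measurable.comp (WithLp.measurable_toLp 2 _)
  refine hasPDF_of_map_le (Y := projectedVector X E) (hP.comp_aemeasurable hXv) fun A hA => ?_
  have hmap : μ.map (projectedVector X E) =
      (μ.map fun ω i => X i ω).map
        fun x : Fin n → ℝ => E.orthogonalProjectionOnto (WithLp.toLp 2 x) :=
    (AEMeasurable.map_map_of_aemeasurable hP.aemeasurable hXv).symm
  rw [hmap, Measure.map_apply hP hA, hjoint, withDensity_apply _ (hP hA), ← hd, mul_assoc]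
  exact setLIntegral_prod_le E hint h0 h1 hK hfK hA
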